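/- For a real number $x$ let $\log^* x$ be the least $k\ge 0$ such that applying $\log_2$ to $x$ $k$ times gives a value at most $1$ (so $\log^* x=0$ for $x\le 1$). For a totally ordered set $X$ and an integer $\ell\ge 1$, let $\mathrm{THRESH}_X^\ell=\{c_{\vec a}:\vec a\in X^\ell\}$ be the class of predicates $c_{\vec a}:X^\ell\to\{0,1\}$ with $c_{\vec a}(\vec x)=1$ if and only if $x_i\le a_i$ for all $1\le i\le \ell$. For a predicate $q$ on $X^\ell$ and a database $D=(D_1,\dots,D_n)\in (X^\ell)^n$ write $q(D)=\frac1n\sum_{i=1}^n q(D_i)$. A randomized algorithm $A$ that maps databases $D\in (X^\ell)^n$ to families of answers $(a_q)_q\in\mathbb R^{\mathrm{THRESH}_X^\ell}$ is $(\varepsilon,\delta)$-differentially private if $\Pr[A(D)\in T]\le e^{\varepsilon}\Pr[A(D')\in T]+\delta$ for all databases $D,D'$ that differ in at most one row and all measurable sets $T$. It releases $\mathrm{THRESH}_X^\ell$ with $(\alpha,\beta)$-accuracy if for every $D\in (X^\ell)^n$, with probability at least $1-\beta$ its output satisfies $|a_q-q(D)|\le\alpha$ for all $q\in\mathrm{THRESH}_X^\ell$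 simultaneously. **Theorem.** There is an absolute constant $c>0$ such that the following holds for every totally ordered set $X$, all integers $n,\ell\ge 1$, every real $\alpha$ with $0<\alpha\le \frac1{150}$, and every real $\delta\le\min\{\ell^2/(7500n^2),\,1/2\}$. If there is a $(\frac1{150},\delta)$-differentially private algorithm on databases of $n$ rows that releases $\mathrm{THRESH}_X^\ell$ with $(\alpha,\frac1{150})$-accuracy, then $X$ is finite and $$n\;\ge\; c\cdot\frac{\ell}{\alpha}\cdot\log^*|X| .$$ -/

import Mathlib

open MeasureTheory

/-- `M : X^n → Y` is `(ε, δ)`-differentially private. The randomized algorithm is given by the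
law `M x` of its output on each dataset `x`; neighbouring datasets differ in (at most) one row. -/
def IsDifferentiallyPrivate {U Y : Type*} [MeasurableSpace Y] {n : ℕ} (ε δ : ℝ)
    (M : (Fin n → U) → ProbabilityMeasure Y) : Prop :=
  ∀ x x' : Fin n → U, (∃ i, ∀ j, j ≠ i → x j = x' j) →
    ∀ T : Set Y, MeasurableSet T →
      (M x : Measure Y).real T ≤ Real.exp ε * (M x' : Measure Y).real T + δ

/-- The value `q(D)` of the counting query `q` on the database `D`: the fraction of the rows of
`D` that satisfy `q`. -/
noncomputable def countingQueryValue {U : Type*} {n : ℕ} (q : U → Bool) (D : Fin n → U) : ℝ :=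
  (∑ i, if q (D i) = true then (1 : ℝ) else 0) / n

/-- The answers `a = (a_q)_{q ∈ Q}` are `α`-accurate for `Q` on the database `D`. -/
def IsAccurateAnswer {U : Type*} {n : ℕ} (Q : Set (U → Bool)) (α : ℝ) (D : Fin n → U)
    (a : Q → ℝ) : Prop :=
  ∀ q : Q, |a q - countingQueryValue (q : U → Bool) D| ≤ α

/-- The randomized algorithm `A : U^n → ℝ^Q` is `(α, β)`-accurate for the query class `Q`: on every
database its output is `α`-accurate with probability at least `1 - β`. (For uncountable `Q` the
event need not be measurable, and its probability is then the outer one.) -/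
def IsAccurateRelease {U : Type*} {n : ℕ} (Q : Set (U → Bool)) (α β : ℝ)
    (A : (Fin n → U) → ProbabilityMeasure (Q → ℝ)) : Prop :=
  ∀ D : Fin n → U, 1 - β ≤ (A D : Measure (Q → ℝ)).real {a | IsAccurateAnswer Q α D a}

/-- The `l`-dimensional threshold function `c_a`, with `c_a(x) = 1` iff `x i ≤ a i` for all `i`. -/
def thresholdConcept {X : Type*} [LinearOrder X] {l : ℕ} (a : Fin l → X) : (Fin l → X) → Bool :=
  fun x => decide (∀ i, x i ≤ a i)

/-- The class of all `l`-dimensional threshold functions over `X^l`. -/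
def thresholdClass (X : Type*) [LinearOrder X] (l : ℕ) : Set ((Fin l → X) → Bool) :=
  Set.range (thresholdConcept (X := X) (l := l))

/-- The iterated logarithm `log* x`: how many times `log₂` has to be applied to `x` until the
result is at most `1`. -/
noncomputable def logStar (x : ℝ) : ℕ :=
  sInf {k : ℕ | (Real.logb 2)^[k] x ≤ 1}

/-! Privately finding an interior point of a database over a large ordered set needs about log* of
its size in rows, and releasing `l`-dimensional thresholds with error `α` solves most of about `l`
independent instances of that problem at once.

For one instance the hardness is recursive (`InteriorPointHard.succ`). Given a hard database of
positions `x_i` in `Fin s`, pick a random string `u` of length `s` over `b` letters; the new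
database holds `u` itself and, for each `i`, a string sharing with `u` the first `x_i` digits only.
In lexicographic order, an interior point agrees with `u` at least up to the smallest `x_i`. Either
its first difference from `u` is an interior point of the `x_i`, or it guesses the digit of `u` at
the largest `x_i`. Only the row `u` reveals that digit, so privacy bounds the guess by `e^ε / b +
δ`. Each extra row thus exponentiates the universe at small cost.

Hardness is stated for a distribution, not for worst-case databases, so that `k` independent copies
can be drawn: any private mechanism then solves at most a `p` fraction of them on average
(`interiorPointHard_product`). Conversely, put instance `i` on coordinate axis `i`. Threshold
answers then approximate all sums of one-dimensional counts, and the medians of any databases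
consistent with the answers are interior points for most instances (`card_not_isInteriorPoint_le`).
The two bounds conflict unless `|X|` lies below a tower of height about `α n / l`. -/

/-- The total weight of `T` under the weight function `w`. -/
noncomputable def mass {O : Type*} [Fintype O] (w : O → ℝ) (T : Set O) : ℝ :=
  ∑ o, T.indicator w o

/-- A randomized algorithm with finitely many outputs, given by the weights of the outputs, is
`(ε, δ)`-private for the adjacency relation `adj`. -/
structure IsPrivateMechanism {I O : Type*} [Fintype O] (adj : I → I → Prop) (ε δ : ℝ)
    (M : I → O → ℝ) : Prop where
  nonneg : ∀ x o, 0 ≤ M x o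
  sum_eq_one : ∀ x, ∑ o, M x o = 1
  mass_le : ∀ x x', adj x x' → ∀ T, mass (M x) T ≤ Real.exp ε * mass (M x') T + δ

/-- Databases that differ in at most one row. -/
def RowAdjacent {U : Type*} {n : ℕ} (x x' : Fin n → U) : Prop :=
  ∃ i, ∀ j, j ≠ i → x j = x' j

/-- `z` lies between two elements of the database `x`. -/
def IsInteriorPoint {X : Type*} [LE X] {n : ℕ} (x : Fin n → X) (z : X) : Prop :=
  (∃ i, x i ≤ z) ∧ ∃ i, z ≤ x i

/-- There is a distribution on databases of `n` elements of `X`, uniform over a finite set of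
seeds, on which no `(ε, δ)`-private mechanism finds an interior point with probability more than
`p`. -/
def InteriorPointHard (ε δ p : ℝ) (n : ℕ) (X : Type) [LE X] [Fintype X] : Prop :=
  ∃ (R : Type) (_ : Fintype R) (_ : Nonempty R) (g : R → Fin n → X),
    ∀ M : (Fin n → X) → X → ℝ, IsPrivateMechanism RowAdjacent ε δ M →
      ∑ r, mass (M (g r)) {z | IsInteriorPoint (g r) z} ≤ p * Fintype.card R

/-! ### Masses and reductions between finite mechanisms -/

section Mass

variable {O : Type*} [Fintype O]

lemma mass_mono {w : O → ℝ} (hw : ∀ o, 0 ≤ w o) {S T : Set O} (h : S ⊆ T) :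
    mass w S ≤ mass w T :=
  Finset.sum_le_sum fun o _ => Set.indicator_le_indicator_of_subset h hw o

lemma mass_union_le {w : O → ℝ} (hw : ∀ o, 0 ≤ w o) (S T : Set O) :
    mass w (S ∪ T) ≤ mass w S + mass w T := by
  classical
  rw [mass, mass, mass, ← Finset.sum_add_distrib]
  refine Finset.sum_le_sum fun o _ => ?_
  have := hw o
  by_cases h1 : o ∈ S <;> by_cases h2 : o ∈ T <;> simp [h1, h2, this]

lemma sum_mass_fiber {C : Type*} [Fintype C] (w : O → ℝ) (f : O → C) :
    ∑ c, mass w {o | f o = c} = ∑ o, w o := by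
  classical
  simp only [mass, Set.indicator_apply, Set.mem_ofPred_eq]
  rw [Finset.sum_comm]
  simp

lemma mass_fiber {C : Type*} [Fintype C] (w : O → ℝ) (f : O → C) (T : Set C) :
    mass (fun c => mass w {o | f o = c}) T = mass w (f ⁻¹' T) := by
  classical
  simp only [mass, Set.indicator_apply, Set.mem_ofPred_eq, Set.mem_preimage]
  have : ∀ c, (if c ∈ T then ∑ o, (if f o = c then w o else 0) else 0)
      = ∑ o, if f o = c then (if c ∈ T then w o else 0) else 0 := by
    intro c
    split_ifs <;> simp
  simp only [this]
  rw [Finset.sum_comm]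
  simp

lemma mass_sum_div {R : Type*} [Fintype R] (w : R → O → ℝ) (c : ℝ) (T : Set O) :
    mass (fun o => (∑ r, w r o) / c) T = (∑ r, mass (w r) T) / c := by
  classical
  simp only [mass, Set.indicator_apply]
  rw [Finset.sum_comm, Finset.sum_div]
  refine Finset.sum_congr rfl fun o _ => ?_
  split_ifs <;> simp

end Mass

/-- Running `M` on `h r x` for a uniformly random seed `r`, and applying `f r` to its output. -/
noncomputable def seededMechanism {I J O C R : Type*} [Fintype O] [Fintype R] (M : I → O → ℝ)
    (h : R → J → I) (f : R → O → C) : J → C → ℝ :=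
  fun x c => (∑ r, mass (M (h r x)) {o | f r o = c}) / Fintype.card R

section Seeded

variable {I J O C R : Type*} [Fintype O] [Fintype C] [Fintype R]

lemma mass_seededMechanism (M : I → O → ℝ) (h : R → J → I) (f : R → O → C) (x : J) (T : Set C) :
    mass (seededMechanism M h f x) T
      = (∑ r, mass (M (h r x)) (f r ⁻¹' T)) / Fintype.card R := by
  unfold seededMechanism
  rw [mass_sum_div]
  simp only [mass_fiber]

/-- Privacy survives because each fixed seed preserves adjacency, post-processing is free, and the
inequality averages over seeds. All reductions below have this form. -/
lemma IsPrivateMechanism.seeded [Nonempty R] {adj : I → I → Prop} {adj' : J → J → Prop} {ε δ : ℝ}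
    {M : I → O → ℝ} (hM : IsPrivateMechanism adj ε δ M) {h : R → J → I} (f : R → O → C)
    (hh : ∀ r x x', adj' x x' → adj (h r x) (h r x')) :
    IsPrivateMechanism adj' ε δ (seededMechanism M h f) := by
  have hR : (0 : ℝ) < Fintype.card R := by exact_mod_cast Fintype.card_pos
  refine ⟨fun x c => ?_, fun x => ?_, fun x x' hx T => ?_⟩
  · refine div_nonneg (Finset.sum_nonneg fun r _ => Finset.sum_nonneg fun o _ => ?_) hR.le
    exact Set.indicator_nonneg (fun _ _ => hM.nonneg _ _) _
  · unfold seededMechanism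
    rw [← Finset.sum_div, Finset.sum_comm]
    simp only [sum_mass_fiber, hM.sum_eq_one]
    simp [hR.ne']
  · rw [mass_seededMechanism, mass_seededMechanism, div_le_iff₀ hR, add_mul, mul_assoc,
      div_mul_cancel₀ _ hR.ne', Finset.mul_sum]
    calc _ ≤ ∑ r, (Real.exp ε * mass (M (h r x')) (f r ⁻¹' T) + δ) :=
          Finset.sum_le_sum fun r _ => hM.mass_le _ _ (hh r _ _ hx) _
      _ = _ := by rw [Finset.sum_add_distrib]; simp [mul_comm]

end Seeded

/-- Resampling one coordinate of a uniform vector leaves it uniform. -/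
lemma sum_sum_update {ι β : Type*} [Fintype ι] [DecidableEq ι] [Fintype β] (i : ι)
    (h : (ι → β) → ℝ) :
    ∑ r : ι → β, ∑ c : β, h (Function.update r i c) = Fintype.card β * ∑ r, h r := by
  have key : ∀ F : (ι → β) → ℝ, ∑ r, F r
      = ∑ c : β, ∑ q : {j // j ≠ i} → β, F ((Equiv.funSplitAt i β).symm (c, q)) := by
    intro F
    rw [← Fintype.sum_prod_type', ← Equiv.sum_comp (Equiv.funSplitAt i β).symm F]
  have upd : ∀ (c d : β) (q : {j // j ≠ i} → β),
      Function.update ((Equiv.funSplitAt i β).symm (c, q)) i d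
        = (Equiv.funSplitAt i β).symm (d, q) := by
    intro c d q
    ext j
    by_cases hj : j = i
    · subst hj; simp [Equiv.funSplitAt, Equiv.piSplitAt]
    · simp [Equiv.funSplitAt, Equiv.piSplitAt, hj]
  rw [key, key h]
  simp only [upd]
  rw [Finset.sum_const, Finset.card_univ, nsmul_eq_mul, Finset.sum_comm]

/-! ### Hard distributions for interior points: base case and recursion -/

lemma InteriorPointHard.mono {ε δ p p' : ℝ} {n : ℕ} {X : Type} [LE X] [Fintype X]
    (h : InteriorPointHard ε δ p n X) (hp : p ≤ p') : InteriorPointHard ε δ p' n X := by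
  obtain ⟨R, _, _, g, hg⟩ := h
  exact ⟨R, _, ‹_›, g, fun M hM => (hg M hM).trans (by gcongr)⟩

lemma InteriorPointHard.congr {ε δ p : ℝ} {n : ℕ} {X Y : Type} [LE X] [LE Y] [Fintype X]
    [Fintype Y] (h : InteriorPointHard ε δ p n X) (e : X ≃o Y) : InteriorPointHard ε δ p n Y := by
  obtain ⟨R, hR, hR', g, hg⟩ := h
  refine ⟨R, hR, hR', fun r => e ∘ g r, fun M hM => ?_⟩
  have hM' : IsPrivateMechanism RowAdjacent ε δ
      (seededMechanism M (fun (_ : Unit) (x : Fin n → X) => e ∘ x) fun _ => e.symm) := by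
    refine hM.seeded _ fun _ x x' ⟨i, hi⟩ => ⟨i, fun j hj => ?_⟩
    simp [hi j hj]
  refine le_trans (le_of_eq ?_) (hg _ hM')
  refine Finset.sum_congr rfl fun r _ => ?_
  rw [mass_seededMechanism]
  simp only [Finset.univ_unique, Finset.sum_singleton, Fintype.card_unit, Nat.cast_one, div_one]
  congr 1
  ext z
  simp [IsInteriorPoint, OrderIso.le_symm_apply, OrderIso.symm_apply_le]

/-- A single database entry, `0` or `1`, cannot be recovered privately. -/
lemma interiorPointHard_one {ε : ℝ} (hε : 0 ≤ ε) (δ : ℝ) :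
    InteriorPointHard ε δ ((Real.exp ε + δ) / 2) 1 (Fin 2) := by
  refine ⟨Fin 2, inferInstance, inferInstance, fun r _ => r, fun M hM => ?_⟩
  have hset : ∀ r : Fin 2, {z | IsInteriorPoint (fun _ : Fin 1 => r) z} = {r} := by
    intro r
    ext z
    simp [IsInteriorPoint, le_antisymm_iff, and_comm]
  have hm : ∀ (w : Fin 2 → ℝ) (r : Fin 2), mass w {r} = w r := by
    intro w r
    simp [mass, Set.indicator_apply]
  have h1 := hM.mass_le (fun _ => 1) (fun _ => 0)
    ⟨0, fun j hj => absurd (Subsingleton.elim j 0) hj⟩ {1}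
  have h2 := hM.sum_eq_one (fun _ => 0)
  have h3 := hM.nonneg (fun _ => 0) 0
  have h4 := Real.one_le_exp hε
  simp only [hset, hm, Fin.sum_univ_two] at h1 h2 ⊢
  simp only [Fintype.card_fin, Nat.cast_ofNat]
  rw [← eq_sub_iff_add_eq'] at h2
  rw [h2] at h1
  nlinarith

/-- The sum over `u` of the masses of the outputs that guess the `t`-th digit of `u`, when the
weights do not depend on this digit. -/
lemma sum_mass_digit {ι β : Type*} [Fintype ι] [DecidableEq ι] [Fintype β] [Nonempty β]
    {O : Type*} [Fintype O] (w : (ι → β) → O → ℝ) (hw : ∀ u, ∑ o, w u o = 1) (t : ι)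
    (hwt : ∀ u c, w (Function.update u t c) = w u) (digit : O → β) :
    ∑ u, mass (w u) {o | digit o = u t} = Fintype.card (ι → β) / (Fintype.card β : ℝ) := by
  have hβ : (Fintype.card β : ℝ) ≠ 0 := by exact_mod_cast Fintype.card_ne_zero
  -- Resample digit `t`: the weights stay fixed, and each output is right for exactly one of the
  -- values.
  rw [eq_div_iff hβ, mul_comm,
    ← sum_sum_update t fun u => mass (w u) {o | digit o = u t}]
  simp only [hwt, Function.update_self, sum_mass_fiber, hw]
  simp

/-- The first position where `z` and `u` differ (the last position if there is none). -/
noncomputable def firstDiff {s : ℕ} {β : Type*} (hs : 0 < s) (u z : Fin s → β) : Fin s :=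
  open Classical in
  if h : ∃ k : ℕ, ∃ hk : k < s, z ⟨k, hk⟩ ≠ u ⟨k, hk⟩ then
    -- The default `s - 1` keeps both bounds below valid when `z = u`.
    ⟨Nat.find h, (Nat.find_spec h).1⟩ else ⟨s - 1, by omega⟩

section FirstDiff

variable {s : ℕ} {β : Type*} (hs : 0 < s) {u z : Fin s → β}

include hs

lemma eq_of_lt_firstDiff {j : Fin s} (hj : j < firstDiff hs u z) : z j = u j := by
  classical
  unfold firstDiff at hj
  split_ifs at hj with h
  · have := Nat.find_min h (m := j) hj
    push Not at this
    exact this j.2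
  · push Not at h
    exact h j j.2

lemma le_firstDiff {x : Fin s} (h : ∀ j < x, z j = u j) : x ≤ firstDiff hs u z := by
  classical
  unfold firstDiff
  split_ifs with hk
  · obtain ⟨hk1, hk2⟩ := Nat.find_spec hk
    by_contra hlt
    rw [not_le] at hlt
    exact hk2 (h _ hlt)
  · rw [Fin.le_def]
    have := x.2
    simp only
    omega

end FirstDiff

/-- The string `v`, with the digits before position `x` replaced by those of `u`. -/
def spliceString {s : ℕ} {β : Type*} (u v : Fin s → β) (x : Fin s) : Lex (Fin s → β) :=
  toLex fun j => if j < x then u j else v j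

/-- Strings with a common prefix form an interval of the lexicographic order. -/
lemma eq_of_lex_between {s : ℕ} {β : Type*} [LinearOrder β] {x : Fin s} {u : Fin s → β}
    {y y' z : Lex (Fin s → β)} (hy : ∀ j < x, ofLex y j = u j) (hy' : ∀ j < x, ofLex y' j = u j)
    (h1 : y ≤ z) (h2 : z ≤ y') : ∀ j < x, ofLex z j = u j := by
  intro j
  induction j using WellFoundedLT.induction with
  | ind j ih =>
    intro hj
    have ihj : ∀ i < j, ofLex z i = u i := fun i hi => ih i hi (hi.trans hj)
    refine le_antisymm ?_ ?_
    · rw [← hy' j hj]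
      by_contra hlt
      rw [not_le] at hlt
      refine absurd h2 (not_le.2 ?_)
      exact ⟨j, fun i hi => (hy' i (hi.trans hj)).trans (ihj i hi).symm, hlt⟩
    · rw [← hy j hj]
      by_contra hlt
      rw [not_le] at hlt
      refine absurd h1 (not_le.2 ?_)
      exact ⟨j, fun i hi => (ihj i hi).trans (hy i (hi.trans hj)).symm, hlt⟩

/-- Passing from a hard distribution over `Fin s` to one over the strings of length `s` over an
alphabet of `b` letters, with one more row. -/
lemma InteriorPointHard.succ {ε δ p : ℝ} {n s b : ℕ} (hn : 0 < n) (hb : 0 < b)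
    (h : InteriorPointHard ε δ p n (Fin s)) :
    InteriorPointHard ε δ (p + Real.exp ε / b + δ) (n + 1) (Lex (Fin s → Fin b)) := by
  classical
  obtain ⟨R, hR, hR', g, hg⟩ := h
  have : NeZero b := ⟨hb.ne'⟩
  have : NeZero n := ⟨hn.ne'⟩
  have hs : 0 < s := (Nat.zero_le _).trans_lt (g hR'.some 0).2
  let V := Fin n → Fin s → Fin b
  let rows : (Fin s → Fin b) → V → (Fin n → Fin s) → Fin n → Lex (Fin s → Fin b) :=
    fun u v x i => spliceString u (v i) (x i)
  let db : (Fin s → Fin b) → V → (Fin n → Fin s) → Fin (n + 1) → Lex (Fin s → Fin b) :=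
    fun u v x => Fin.cons (toLex u) (rows u v x)
  refine ⟨R × V × (Fin s → Fin b), inferInstance, inferInstance,
    fun r => db r.2.2 r.2.1 (g r.1), fun M hM => ?_⟩
  -- The reduction: draw `u` and `v`, build the string database from the positions `x`, and return
  -- where the output leaves `u`.
  let M' := seededMechanism M (fun (q : V × (Fin s → Fin b)) x => db q.2 q.1 x)
    fun q z => firstDiff hs q.2 (ofLex z)
  have hM' : IsPrivateMechanism RowAdjacent ε δ M' := by
    refine hM.seeded _ fun q x x' ⟨i, hi⟩ => ⟨i.succ, fun j hj => ?_⟩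
    induction j using Fin.cases with
    | zero => rfl
    | succ j =>
      have : j ≠ i := fun hji => hj (by rw [hji])
      simp [db, rows, hi j this]
  -- the largest entry of the database of `r`
  have htop : ∀ r, ∃ i, ∀ k, g r k ≤ g r i := fun r => Finite.exists_max (g r)
  choose top htop using htop
  let guess : R → (Fin s → Fin b) → Set (Lex (Fin s → Fin b)) :=
    fun r u => {z | ofLex z (g r (top r)) = u (g r (top r))}
  -- All rows agree with `u` before the smallest position, hence so does `z`; and if `z` left `u`
  -- only after the largest position, it would match the digit there.
  have hcover : ∀ r v u, {z | IsInteriorPoint (db u v (g r)) z} ⊆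
      ((fun z => firstDiff hs u (ofLex z)) ⁻¹' {z | IsInteriorPoint (g r) z}) ∪ guess r u := by
    rintro r v u z ⟨⟨i, hi⟩, ⟨i', hi'⟩⟩
    by_cases hgu : z ∈ guess r u
    · exact Or.inr hgu
    refine Or.inl ⟨?_, top r, ?_⟩
    · obtain ⟨lo, hlo⟩ := Finite.exists_min (g r)
      have hag : ∀ (i : Fin (n + 1)), ∀ j < g r lo, ofLex (db u v (g r) i) j = u j := by
        intro i j hj
        induction i using Fin.cases with
        | zero => rfl
        | succ i => simp [db, rows, spliceString, hj.trans_le (hlo i)]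
      exact ⟨lo, le_firstDiff hs (eq_of_lex_between (hag i) (hag i') hi hi')⟩
    · by_contra hlt
      rw [not_le] at hlt
      exact hgu (eq_of_lt_firstDiff hs hlt)
  -- Overwriting row `0` by a constant removes the only row that depends on the digit of `u` at the
  -- largest position.
  have hpriv : ∀ r v u, mass (M (db u v (g r))) (guess r u)
      ≤ Real.exp ε * mass (M (Fin.cons (toLex fun _ => 0) (rows u v (g r)))) (guess r u) + δ := by
    refine fun r v u => hM.mass_le _ _ ⟨0, fun j hj => ?_⟩ _
    obtain ⟨j, rfl⟩ := Fin.exists_succ_eq.2 hj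
    simp [db]
  have hguess : ∀ r v, ∑ u, mass (M (db u v (g r))) (guess r u)
      ≤ (Real.exp ε / b + δ) * Fintype.card (Fin s → Fin b) := by
    intro r v
    refine (Finset.sum_le_sum fun u _ => hpriv r v u).trans (le_of_eq ?_)
    have := sum_mass_digit
      (fun u : Fin s → Fin b => M (Fin.cons (toLex fun _ => 0) (rows u v (g r))))
      (fun u => hM.sum_eq_one _) (g r (top r)) (fun u c => ?_)
      (fun z => ofLex z (g r (top r)))
    · rw [Finset.sum_add_distrib, ← Finset.mul_sum, this]
      simp only [Finset.sum_const, Finset.card_univ, nsmul_eq_mul, Fintype.card_fin]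
      ring
    · congr 2
      refine funext fun i => congrArg toLex (funext fun j => ?_)
      by_cases hj : j < g r i
      · have : j ≠ g r (top r) := (hj.trans_le (htop r i)).ne
        simp [hj, this]
      · simp [hj]
  have hlow := hg M' hM'
  simp only [M', mass_seededMechanism] at hlow
  rw [← Finset.sum_div, div_le_iff₀ (by exact_mod_cast Fintype.card_pos)] at hlow
  calc ∑ r : R × V × (Fin s → Fin b), mass (M (db r.2.2 r.2.1 (g r.1)))
        {z | IsInteriorPoint (db r.2.2 r.2.1 (g r.1)) z}
      ≤ ∑ r : R × V × (Fin s → Fin b), (mass (M (db r.2.2 r.2.1 (g r.1)))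
          ((fun z => firstDiff hs r.2.2 (ofLex z)) ⁻¹' {z | IsInteriorPoint (g r.1) z})
          + mass (M (db r.2.2 r.2.1 (g r.1))) (guess r.1 r.2.2)) := by
        refine Finset.sum_le_sum fun r _ => ?_
        exact (mass_mono (hM.nonneg _) (hcover _ _ _)).trans (mass_union_le (hM.nonneg _) _ _)
    _ = (∑ r : R, ∑ q : V × (Fin s → Fin b), mass (M (db q.2 q.1 (g r)))
          ((fun z => firstDiff hs q.2 (ofLex z)) ⁻¹' {z | IsInteriorPoint (g r) z}))
        + ∑ r : R, ∑ v : V, ∑ u, mass (M (db u v (g r))) (guess r u) := by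
        rw [Finset.sum_add_distrib, Fintype.sum_prod_type, Fintype.sum_prod_type]
        simp only [Fintype.sum_prod_type]
    _ ≤ p * Fintype.card R * Fintype.card (V × (Fin s → Fin b))
        + ∑ r : R, ∑ v : V, (Real.exp ε / b + δ) * Fintype.card (Fin s → Fin b) :=
        add_le_add hlow (Finset.sum_le_sum fun r _ => Finset.sum_le_sum fun v _ => hguess r v)
    _ = _ := by
        simp only [Finset.sum_const, Finset.card_univ, nsmul_eq_mul, Fintype.card_prod]
        push_cast
        ring

/-! ### Many independent instances -/

/-- Independent instances of the interior point problem: a mechanism that is private with respect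
to changing one row of one instance solves, on average, at most a `p` fraction of them. -/
lemma interiorPointHard_product {ε δ p : ℝ} {m s : ℕ} (h : InteriorPointHard ε δ p m (Fin s))
    (k : ℕ) : ∃ (R : Type) (_ : Fintype R) (_ : Nonempty R) (g : R → Fin k → Fin m → Fin s),
      ∀ M : (Fin k → Fin m → Fin s) → (Fin k → Fin s) → ℝ,
        IsPrivateMechanism
          (fun D D' => ∃ i j, ∀ i' j', (i', j') ≠ (i, j) → D i' j' = D' i' j') ε δ M →
        ∑ r, ∑ i, mass (M (g r)) {y | IsInteriorPoint (g r i) (y i)} ≤ p * k * Fintype.card R := by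
  classical
  obtain ⟨R, hR, hR', g, hg⟩ := h
  refine ⟨Fin k → R, inferInstance, inferInstance, fun r i => g (r i), fun M hM => ?_⟩
  rw [Finset.sum_comm]
  have key : ∀ i : Fin k, ∑ r : Fin k → R,
      mass (M fun i => g (r i)) {y | IsInteriorPoint (g (r i)) (y i)}
        ≤ p * Fintype.card (Fin k → R) := by
    intro i
    -- A solver for one instance: place the input at index `i` and draw all other instances afresh.
    let M' := seededMechanism M
      (fun (r : Fin k → R) (D : Fin m → Fin s) => Function.update (fun i => g (r i)) i D)
      fun _ y => y i
    have hM' : IsPrivateMechanism RowAdjacent ε δ M' := by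
      refine hM.seeded _ fun r x x' ⟨j, hj⟩ => ⟨i, j, fun i' j' hij => ?_⟩
      by_cases hi : i' = i
      · subst hi
        have : j' ≠ j := fun hjj => hij (by rw [hjj])
        simp [hj j' this]
      · simp [hi]
    have hlow := hg M' hM'
    simp only [M', mass_seededMechanism] at hlow
    rw [← Finset.sum_div, div_le_iff₀ (by exact_mod_cast Fintype.card_pos),
      Finset.sum_comm] at hlow
    have hupd := sum_sum_update i fun r : Fin k → R =>
      mass (M fun i => g (r i)) {y | IsInteriorPoint (g (r i)) (y i)}
    have hcard : (0 : ℝ) < Fintype.card R := by exact_mod_cast Fintype.card_pos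
    refine le_of_mul_le_mul_left ?_ hcard
    rw [← hupd]
    refine le_trans (le_of_eq ?_) (hlow.trans (le_of_eq (by ring)))
    refine Finset.sum_congr rfl fun r _ => Finset.sum_congr rfl fun c _ => ?_
    have : (fun i' => g (Function.update r i c i'))
        = Function.update (fun i' => g (r i')) i (g c) := by
      ext i' : 1
      by_cases hi : i' = i
      · subst hi; simp
      · simp [hi]
    rw [this]
    simp only [Function.update_self]
    rfl
  refine (Finset.sum_le_sum fun i _ => key i).trans (le_of_eq ?_)
  simp only [Finset.sum_const, Finset.card_univ, nsmul_eq_mul, Fintype.card_fin]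
  ring

/-! ### Counts and medians -/

/-- The number of entries of `x` that are at most `a`. -/
def countLE {m s : ℕ} (x : Fin m → Fin s) (a : Fin s) : ℝ :=
  ∑ j, if x j ≤ a then 1 else 0

section CountLE

variable {m s : ℕ}

lemma countLE_of_forall_le {x : Fin m → Fin s} {a : Fin s} (h : ∀ j, x j ≤ a) :
    countLE x a = m := by
  simp [countLE, h]

lemma countLE_of_forall_lt {x : Fin m → Fin s} {a : Fin s} (h : ∀ j, a < x j) :
    countLE x a = 0 := by
  simp [countLE, h]

lemma exists_forall_le_fin (hs : 0 < s) : ∃ t : Fin s, ∀ a, a ≤ t :=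
  ⟨⟨s - 1, by omega⟩, fun a => by rw [Fin.le_def]; have := a.2; simp only; omega⟩

lemma exists_median (hs : 0 < s) (x : Fin m → Fin s) :
    ∃ a, (m : ℝ) / 2 ≤ countLE x a ∧ ∀ a' < a, countLE x a' ≤ m / 2 := by
  obtain ⟨t, ht⟩ := exists_forall_le_fin hs
  have hne : {a | (m : ℝ) / 2 ≤ countLE x a}.Nonempty := by
    refine ⟨t, ?_⟩
    rw [Set.mem_ofPred_eq, countLE_of_forall_le fun j => ht _]
    have : (0 : ℝ) ≤ m := Nat.cast_nonneg m
    linarith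
  obtain ⟨a, ha, hmin⟩ := wellFounded_lt.has_min _ hne
  refine ⟨a, ha, fun a' ha' => ?_⟩
  by_contra hlt
  exact hmin a' (le_of_lt (not_le.1 hlt)) ha'

/-- If two families of databases have similar sums of counts, then the median of most members of
the second family is an interior point of the corresponding member of the first. -/
lemma card_not_isInteriorPoint_le {k : ℕ} (hs : 0 < s) (hm : 0 < m) {τ : ℝ}
    {D D' : Fin k → Fin m → Fin s}
    (hD : ∀ a : Fin k → Fin s, |∑ i, countLE (D i) (a i) - ∑ i, countLE (D' i) (a i)| ≤ τ)
    {y : Fin k → Fin s} (hy : ∀ i, (m : ℝ) / 2 ≤ countLE (D' i) (y i))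
    (hy' : ∀ i, ∀ a < y i, countLE (D' i) a ≤ m / 2) :
    (Nat.card {i // ¬ IsInteriorPoint (D i) (y i)} : ℝ) * m ≤ 4 * τ := by
  classical
  obtain ⟨t, ht⟩ := exists_forall_le_fin hs
  have htop : ∀ x : Fin m → Fin s, countLE x t = m := fun x =>
    countLE_of_forall_le fun j => ht _
  have hA : ∑ i, (if ∀ j, y i < D i j then (m : ℝ) / 2 else 0) ≤ τ := by
    -- Ask for `y i` at the bad indices and for the top elsewhere. Each bad index contributes at
    -- least `m / 2` with the same sign, the others cancel exactly, so a single query bounds their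
    -- number.
    refine le_trans ?_ ((neg_le_abs _).trans (hD fun i => if ∀ j, y i < D i j then y i else t))
    rw [neg_sub, ← Finset.sum_sub_distrib]
    refine Finset.sum_le_sum fun i _ => ?_
    split_ifs with h
    · rw [countLE_of_forall_lt h]
      linarith [hy i]
    · rw [htop, htop, sub_self]
  -- Symmetrically, with the maximum of `D i` as threshold: it counts `m` in `D i`, and at most `m /
  -- 2` in `D' i` because it lies below the median.
  have hB : ∑ i, (if ∀ j, D i j < y i then (m : ℝ) / 2 else 0) ≤ τ := by
    have hmax : ∀ i, ∃ j, ∀ j', D i j' ≤ D i j := fun i => by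
      have : NeZero m := ⟨hm.ne'⟩
      exact Finite.exists_max (D i)
    choose top hmax using hmax
    refine le_trans ?_
      ((le_abs_self _).trans (hD fun i => if ∀ j, D i j < y i then D i (top i) else t))
    rw [← Finset.sum_sub_distrib]
    refine Finset.sum_le_sum fun i _ => ?_
    split_ifs with h
    · rw [countLE_of_forall_le (hmax i)]
      linarith [hy' i _ (h (top i))]
    · rw [htop, htop, sub_self]
  have hsum : (Nat.card {i // ¬ IsInteriorPoint (D i) (y i)} : ℝ) * (m / 2)
      = ∑ i, if ¬ IsInteriorPoint (D i) (y i) then (m : ℝ) / 2 else 0 := by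
    rw [Nat.card_eq_fintype_card, Fintype.card_subtype, ← Finset.sum_filter, Finset.sum_const,
      nsmul_eq_mul]
  have hle : ∑ i, (if ¬ IsInteriorPoint (D i) (y i) then (m : ℝ) / 2 else 0) ≤
      ∑ i, ((if ∀ j, y i < D i j then (m : ℝ) / 2 else 0)
        + if ∀ j, D i j < y i then (m : ℝ) / 2 else 0) := by
    refine Finset.sum_le_sum fun i _ => ?_
    have : (0 : ℝ) ≤ m := Nat.cast_nonneg m
    by_cases h1 : ∀ j, y i < D i j
    · rw [if_pos h1]
      split_ifs <;> linarith
    · by_cases h2 : ∀ j, D i j < y i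
      · rw [if_pos h2]
        split_ifs <;> linarith
      · have : IsInteriorPoint (D i) (y i) := by
          push Not at h1 h2
          exact ⟨h1, h2⟩
        simp [h1, h2, this]
  rw [Finset.sum_add_distrib] at hle
  linarith

end CountLE

/-! ### From threshold release to interior points -/

/-- Choose the first admissible candidate in an enumeration. This makes decoding the real-valued
answers measurable. -/
lemma exists_measurable_selection {Ω C : Type*} [MeasurableSpace Ω] [Countable C] [Nonempty C]
    {P : C → Set Ω} (hP : ∀ c, MeasurableSet (P c)) :
    ∃ f : Ω → C, (∀ T : Set C, MeasurableSet (f ⁻¹' T)) ∧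
      ∀ ω c, ω ∈ P c → ω ∈ P (f ω) := by
  classical
  obtain ⟨F, hF⟩ := exists_surjective_nat C
  let S : Set Ω := ⋃ c, P c
  have hS : MeasurableSet S := MeasurableSet.iUnion hP
  have hex : ∀ ω, ∃ N, ω ∈ P (F N) ∪ Sᶜ := by
    intro ω
    by_cases h : ω ∈ S
    · obtain ⟨c, hc⟩ := Set.mem_iUnion.1 h
      obtain ⟨N, rfl⟩ := hF c
      exact ⟨N, Or.inl hc⟩
    · exact ⟨0, Or.inr h⟩
  have hfind : Measurable fun ω => Nat.find (hex ω) :=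
    measurable_find hex fun N => (hP _).union hS.compl
  refine ⟨fun ω => F (Nat.find (hex ω)), fun T => ?_, fun ω c hc => ?_⟩
  · exact hfind (t := F ⁻¹' T) (MeasurableSet.of_discrete)
  · rcases Nat.find_spec (hex ω) with h | h
    · exact h
    · exact absurd (Set.mem_iUnion.2 ⟨c, hc⟩) h

section Embedding

variable {X : Type*} [LinearOrder X] {n l k m s : ℕ}

/-- The database of `n` rows whose row `(i, j)` is `D i j` in the coordinate `i` and minimal in
the other coordinates; all coordinates of the remaining rows are minimal. -/
def axisDatabase (e : Fin s → X) (hs : 0 < s) (E : Fin n ≃ (Fin k × Fin m) ⊕ Fin (n - k * m))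
    (D : Fin k → Fin m → Fin s) : Fin n → Fin l → X :=
  fun r c => Sum.elim (fun q : Fin k × Fin m => if c.1 = q.1.1 then e (D q.1 q.2) else e ⟨0, hs⟩)
    (fun _ => e ⟨0, hs⟩) (E r)

/-- The threshold `a` on the first `k` coordinates, with minimal thresholds on the others. -/
def extendThreshold (e : Fin s → X) (hs : 0 < s) (a : Fin k → Fin s) : Fin l → X :=
  fun c => if h : c.1 < k then e (a ⟨c.1, h⟩) else e ⟨0, hs⟩

/-- Minimal coordinates pass every threshold used here, so row `(i, j)` tests only `D i j ≤ a i` and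
the padding rows always count. -/
lemma countingQueryValue_axisDatabase (e : Fin s ↪o X) (hs : 0 < s)
    (E : Fin n ≃ (Fin k × Fin m) ⊕ Fin (n - k * m)) (hk : k ≤ l)
    (D : Fin k → Fin m → Fin s) (a : Fin k → Fin s) :
    countingQueryValue (thresholdConcept (extendThreshold (l := l) e hs a)) (axisDatabase e hs E D)
      = (∑ i, countLE (D i) (a i) + (n - k * m : ℕ)) / n := by
  have hmin : ∀ (b : Fin k → Fin s) (c : Fin l), e ⟨0, hs⟩ ≤ extendThreshold e hs b c := by
    intro b c
    unfold extendThreshold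
    split_ifs
    · exact e.monotone (Nat.zero_le _)
    · exact le_rfl
  unfold countingQueryValue
  congr 1
  rw [← Equiv.sum_comp E.symm, Fintype.sum_sum_type, Fintype.sum_prod_type]
  congr 1
  · refine Finset.sum_congr rfl fun i _ => Finset.sum_congr rfl fun j _ => ?_
    refine if_congr ?_ rfl rfl
    simp only [thresholdConcept, axisDatabase, Equiv.apply_symm_apply, Sum.elim_inl,
      decide_eq_true_eq]
    constructor
    · intro h
      have := h ⟨i.1, i.2.trans_le hk⟩
      simpa [extendThreshold] using this
    · intro h c
      split_ifs with hc
      · simpa [extendThreshold, hc] using h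
      · exact hmin a c
  · have : ∀ r : Fin (n - k * m), thresholdConcept (extendThreshold (l := l) e hs a)
        (axisDatabase e hs E D (E.symm (Sum.inr r))) = true := by
      intro r
      simpa [thresholdConcept, axisDatabase] using hmin a
    simp [this]

/-- A private and accurate algorithm for thresholds solves `k` instances of the interior point
problem, all but a few of them. -/
lemma InteriorPointHard.le_of_isAccurateRelease {ε δ p α β : ℝ}
    (h : InteriorPointHard ε δ p m (Fin s)) (e : Fin s ↪o X) (hs : 0 < s) (hm : 0 < m)
    (hk : k ≤ l) (hn : 0 < n) (hkm : k * m ≤ n) (hα : 8 * α * n ≤ k * m)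
    {A : (Fin n → (Fin l → X)) → ProbabilityMeasure (thresholdClass X l → ℝ)}
    (hA : IsDifferentiallyPrivate ε δ A) (hacc : IsAccurateRelease (thresholdClass X l) α β A) :
    (1 - β) * (k * m - 8 * α * n) ≤ p * (k * m) := by
  classical
  have hn' : (0 : ℝ) < n := by exact_mod_cast hn
  have hm' : (0 : ℝ) < m := by exact_mod_cast hm
  obtain ⟨R, hR, hR', g, hg⟩ := interiorPointHard_product h k
  have hcard : Fintype.card (Fin n) = Fintype.card ((Fin k × Fin m) ⊕ Fin (n - k * m)) := by
    simp [hkm]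
  let E := Fintype.equivOfCardEq hcard
  let db : (Fin k → Fin m → Fin s) → Fin n → Fin l → X := axisDatabase e hs E
  let q : (Fin k → Fin s) → thresholdClass X l := fun a =>
    ⟨thresholdConcept (extendThreshold e hs a), Set.mem_range_self _⟩
  -- Only finitely many queries enter, so this event is measurable although full accuracy need not
  -- be.
  let P : (Fin k → Fin m → Fin s) → Set (thresholdClass X l → ℝ) := fun D =>
    {v | ∀ a, |v (q a) - (∑ i, countLE (D i) (a i) + (n - k * m : ℕ)) / n| ≤ α}
  have hP : ∀ D, MeasurableSet (P D) := by
    intro D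
    simp only [P, Set.ofPred_forall]
    refine MeasurableSet.iInter fun a => ?_
    refine measurableSet_le ?_ measurable_const
    exact ((measurable_pi_apply (q a)).sub_const _).abs
  have hPacc : ∀ D, {v | IsAccurateAnswer (thresholdClass X l) α (db D) v} ⊆ P D := by
    intro D v hv a
    rw [← countingQueryValue_axisDatabase e hs E hk D a]
    exact hv (q a)
  have : Nonempty (Fin k → Fin m → Fin s) := ⟨fun _ _ => ⟨0, hs⟩⟩
  obtain ⟨dec, hdec, hdecP⟩ := exists_measurable_selection hP
  choose med hmed hmed' using fun x : Fin m → Fin s => exists_median hs x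
  let out : (thresholdClass X l → ℝ) → Fin k → Fin s := fun v i => med (dec v i)
  have hout : ∀ T : Set (Fin k → Fin s), MeasurableSet (out ⁻¹' T) := fun T =>
    hdec ((fun D i => med (D i)) ⁻¹' T)
  let M : (Fin k → Fin m → Fin s) → (Fin k → Fin s) → ℝ := fun D y =>
    (A (db D) : Measure (thresholdClass X l → ℝ)).real (out ⁻¹' {y})
  have hmass : ∀ D T, mass (M D) T
      = (A (db D) : Measure (thresholdClass X l → ℝ)).real (out ⁻¹' T) := by
    intro D T
    have : out ⁻¹' T = ⋃ y ∈ Finset.univ.filter (· ∈ T), out ⁻¹' {y} := by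
      ext v; simp
    rw [this, measureReal_biUnion_finset ?_ fun y _ => hout _, Finset.sum_filter]
    · simp only [mass, Set.indicator_apply, M]
    · intro y _ y' _ hyy
      exact Disjoint.preimage _ (by simpa using hyy)
  have hM : IsPrivateMechanism
      (fun D D' => ∃ i j, ∀ i' j', (i', j') ≠ (i, j) → D i' j' = D' i' j') ε δ M := by
    refine ⟨fun _ _ => measureReal_nonneg, fun D => ?_, fun D D' ⟨i, j, hij⟩ T => ?_⟩
    · have := hmass D Set.univ
      simpa [mass] using this
    · rw [hmass, hmass]
      refine hA _ _ ⟨E.symm (Sum.inl (i, j)), fun r hr => ?_⟩ _ (hout T)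
      simp only [db]
      ext c
      simp only [axisDatabase]
      rcases hEr : E r with ⟨i', j'⟩ | r'
      · have : (i', j') ≠ (i, j) := by
          rintro heq
          rw [heq] at hEr
          exact hr (by rw [← hEr, Equiv.symm_apply_apply])
        simp only [Sum.elim_inl]
        rw [hij _ _ this]
      · simp
  have hlow : ∀ D, (1 - β) * (k * m - 8 * α * n)
      ≤ (∑ i, mass (M D) {y | IsInteriorPoint (D i) (y i)}) * m := by
    intro D
    let G : Set (Fin k → Fin s) :=
      {y | (Nat.card {i // ¬ IsInteriorPoint (D i) (y i)} : ℝ) * m ≤ 8 * α * n}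
    have hG : 1 - β ≤ mass (M D) G := by
      rw [hmass]
      refine (hacc (db D)).trans (measureReal_mono ((hPacc D).trans fun v hv => ?_))
      have hv' := hdecP v D hv
      -- The true and the decoded databases are both `α`-close to the answers, hence `2α`-close to
      -- each other.
      refine (card_not_isInteriorPoint_le (τ := 2 * α * n) hs hm (D' := dec v) (fun a => ?_)
        (fun i => hmed _) fun i => hmed' _).trans (le_of_eq (by ring))
      have h1 := abs_le.1 (hv a)
      have h2 := abs_le.1 (hv' a)
      set c : ℝ := ((n - k * m : ℕ) : ℝ)
      have h3 : |(∑ i, countLE (D i) (a i) + c) / n - (∑ i, countLE (dec v i) (a i) + c) / n|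
          ≤ 2 * α := abs_le.2 ⟨by linarith [h1.1, h1.2, h2.1, h2.2],
            by linarith [h1.1, h1.2, h2.1, h2.2]⟩
      rw [← sub_div, add_sub_add_right_eq_sub, abs_div, abs_of_pos hn', div_le_iff₀ hn'] at h3
      exact h3
    calc (1 - β) * (k * m - 8 * α * n) ≤ mass (M D) G * (k * m - 8 * α * n) :=
          mul_le_mul_of_nonneg_right hG (by linarith)
      _ = ∑ y, G.indicator (M D) y * (k * m - 8 * α * n) := by rw [mass, Finset.sum_mul]
      _ ≤ ∑ y, M D y * ((∑ i, if IsInteriorPoint (D i) (y i) then 1 else 0) * m) := by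
          refine Finset.sum_le_sum fun y _ => ?_
          have hcount : (Nat.card {i // ¬ IsInteriorPoint (D i) (y i)} : ℝ)
              + ∑ i, (if IsInteriorPoint (D i) (y i) then (1 : ℝ) else 0) = k := by
            rw [Nat.card_eq_fintype_card, Fintype.card_subtype, ← Finset.sum_boole,
              ← Finset.sum_add_distrib]
            have : ∀ i, ((if ¬ IsInteriorPoint (D i) (y i) then (1 : ℝ) else 0)
                + if IsInteriorPoint (D i) (y i) then (1 : ℝ) else 0) = 1 := by
              intro i; split_ifs <;> simp
            rw [Finset.sum_congr rfl fun i _ => this i]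
            simp
          by_cases hy : y ∈ G
          · rw [Set.indicator_of_mem hy]
            refine mul_le_mul_of_nonneg_left ?_ (hM.nonneg _ _)
            have hy2 : (Nat.card {i // ¬ IsInteriorPoint (D i) (y i)} : ℝ) * m ≤ 8 * α * n := hy
            rw [← hcount]
            linarith
          · rw [Set.indicator_of_notMem hy, zero_mul]
            refine mul_nonneg (hM.nonneg _ _) (mul_nonneg (Finset.sum_nonneg fun i _ => ?_) hm'.le)
            split_ifs <;> simp
      _ = _ := by
          simp only [mass, Set.indicator_apply, Set.mem_ofPred_eq]
          rw [Finset.sum_comm, Finset.sum_mul]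
          refine Finset.sum_congr rfl fun y _ => ?_
          rw [← mul_assoc, Finset.mul_sum]
          simp
  have hRpos : (0 : ℝ) < Fintype.card R := by exact_mod_cast Fintype.card_pos
  have hup := hg M hM
  have hfin : ∑ _r : R, (1 - β) * (k * m - 8 * α * n) ≤ (p * k * Fintype.card R) * m := by
    refine (Finset.sum_le_sum fun r _ => hlow (g r)).trans ?_
    rw [← Finset.sum_mul]
    exact mul_le_mul_of_nonneg_right hup hm'.le
  rw [Finset.sum_const, Finset.card_univ, nsmul_eq_mul] at hfin
  refine le_of_mul_le_mul_left (hfin.trans (le_of_eq ?_)) hRpos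
  ring

end Embedding

/-! ### Towers and the iterated logarithm -/

/-- The sizes of the universes of the hard distributions over an alphabet of `b` letters. -/
def powTower (b : ℕ) : ℕ → ℕ
  | 0 => 2
  | j + 1 => b ^ powTower b j

lemma interiorPointHard_powTower {ε : ℝ} (hε : 0 ≤ ε) (δ : ℝ) {b : ℕ} (hb : 0 < b) (j : ℕ) :
    InteriorPointHard ε δ ((Real.exp ε + δ) / 2 + j * (Real.exp ε / b + δ)) (j + 1)
      (Fin (powTower b j)) := by
  induction j with
  | zero => exact (interiorPointHard_one hε δ).mono (by simp)
  | succ j ih =>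
    have hcard : Fintype.card (Lex (Fin (powTower b j) → Fin b)) = powTower b (j + 1) := by
      change Fintype.card (Fin (powTower b j) → Fin b) = _
      simp [powTower]
    refine ((ih.succ j.succ_pos hb).congr (Fintype.orderIsoFinOfCardEq _ hcard).symm).mono
      (le_of_eq ?_)
    push_cast
    ring

/-- The tower of powers of two. -/
def twoTower : ℕ → ℕ
  | 0 => 1
  | k + 1 => 2 ^ twoTower k

lemma lt_twoTower (k : ℕ) : k < twoTower k := by
  induction k with
  | zero => simp [twoTower]
  | succ k ih => exact (Nat.succ_le_of_lt ih).trans_lt Nat.lt_two_pow_self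

/-- Stopping as soon as the value is at most `1` means that `logb` is only applied to arguments
above `1`. -/
lemma logStar_le_of_le_twoTower (k : ℕ) : ∀ x : ℝ, x ≤ twoTower k → logStar x ≤ k := by
  suffices h : ∀ x : ℝ, x ≤ twoTower k → ∃ j ≤ k, (Real.logb 2)^[j] x ≤ 1 by
    intro x hx
    obtain ⟨j, hj, hxj⟩ := h x hx
    exact (Nat.sInf_le hxj).trans hj
  induction k with
  | zero => exact fun x hx => ⟨0, le_rfl, by simpa [twoTower] using hx⟩
  | succ k ih =>
    intro x hx
    by_cases h1 : x ≤ 1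
    · exact ⟨0, Nat.zero_le _, h1⟩
    · rw [not_le] at h1
      obtain ⟨j, hj, hxj⟩ := ih (Real.logb 2 x) (by
        rw [Real.logb_le_iff_le_rpow (by norm_num) (by linarith), Real.rpow_natCast]
        simpa [twoTower] using hx)
      exact ⟨j + 1, by omega, hxj⟩

/-- The factor `2 * d` strengthens the induction: it absorbs both the base `2 ^ d` and the new
prefactor into the next exponent. -/
lemma powTower_le_twoTower {d : ℕ} (hd : 5 ≤ d) (j : ℕ) :
    2 * d * powTower (2 ^ d) j ≤ twoTower (d + 1 + j) := by
  have h4 : 4 * d ≤ 2 ^ d := by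
    induction d, hd using Nat.le_induction with
    | base => norm_num
    | succ d hd ih => rw [pow_succ]; omega
  induction j with
  | zero =>
    calc 2 * d * powTower (2 ^ d) 0 = 4 * d := by simp only [powTower]; ring
      _ ≤ 2 ^ d := h4
      _ ≤ 2 ^ twoTower d := Nat.pow_le_pow_right (by norm_num) (lt_twoTower d).le
  | succ j ih =>
    have hpos : 1 ≤ powTower (2 ^ d) j := by
      cases j with
      | zero => simp [powTower]
      | succ j => exact Nat.one_le_pow _ _ (by positivity)
    calc 2 * d * powTower (2 ^ d) (j + 1) ≤ 2 ^ d * (2 ^ d) ^ powTower (2 ^ d) j :=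
          Nat.mul_le_mul_right _ (by omega)
      _ = 2 ^ (d + d * powTower (2 ^ d) j) := by rw [← pow_mul, pow_add]
      _ ≤ 2 ^ twoTower (d + 1 + j) := by
          refine Nat.pow_le_pow_right (by norm_num) (le_trans ?_ ih)
          nlinarith

lemma exists_orderEmbedding_fin {X : Type*} [LinearOrder X] {s : ℕ}
    (h : ¬ (Finite X ∧ Nat.card X < s)) : Nonempty (Fin s ↪o X) := by
  obtain ⟨t, ht⟩ : ∃ t : Finset X, t.card = s := by
    rcases finite_or_infinite X with hX | hX
    · have := Fintype.ofFinite X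
      obtain ⟨t, -, ht⟩ := Finset.exists_subset_card_eq (s := (Finset.univ : Finset X)) (n := s)
        (by
          rw [Finset.card_univ, ← Nat.card_eq_fintype_card]
          exact not_lt.1 fun h' => h ⟨hX, h'⟩)
      exact ⟨t, ht⟩
    · exact Infinite.exists_subset_card_eq X s
  exact ⟨t.orderEmbOfFin ht⟩

/-! ### Choice of parameters -/

theorem mainTheorem9 :
    ∃ c : ℝ, 0 < c ∧
      ∀ (X : Type*) [LinearOrder X] (n l : ℕ) (α δ : ℝ),
        1 ≤ n → 1 ≤ l → 0 < α → α ≤ 1 / 150 →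
        δ ≤ (l : ℝ) ^ 2 / (7500 * (n : ℝ) ^ 2) → δ ≤ 1 / 2 →
        ∀ A : (Fin n → (Fin l → X)) → ProbabilityMeasure (thresholdClass X l → ℝ),
          IsDifferentiallyPrivate (1 / 150) δ A →
          IsAccurateRelease (thresholdClass X l) α (1 / 150) A →
          Finite X ∧ c * ((l : ℝ) / α * (logStar (Nat.card X) : ℝ)) ≤ (n : ℝ) := by
  refine ⟨1 / 640, by norm_num, fun X _ n l α δ hn hl hα hα' hδ hδ' A hA hacc => ?_⟩
  have hn' : (1 : ℝ) ≤ n := by exact_mod_cast hn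
  have hl' : (1 : ℝ) ≤ l := by exact_mod_cast hl
  have hexp : Real.exp (1 / 150) ≤ 1.01 := by
    have h1 := Real.one_sub_le_exp_neg (1 / 150)
    rw [Real.exp_neg, le_inv_comm₀ (by norm_num) (Real.exp_pos _)] at h1
    exact h1.trans (by norm_num)
  have hαn : α * n ≤ 1 / 150 * n := by gcongr
  have hαn0 : 0 < α * n := by positivity
  -- it suffices to find a hard distribution when `X` is infinite or larger than a tower
  have main : ∀ (k m b : ℕ), k ≤ l → 0 < k → k * (m + 1) ≤ n → 0 < b →
      64 * (α * n) ≤ k * (m + 1) →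
      (Real.exp (1 / 150) + δ) / 2 + m * (Real.exp (1 / 150) / b + δ) < 0.86 →
      Finite X ∧ Nat.card X < powTower b m := by
    intro k m b hkl hk hkm hb hm hp
    by_contra hX
    obtain ⟨e⟩ := exists_orderEmbedding_fin hX
    have hs : 0 < powTower b m := by
      cases m with
      | zero => simp [powTower]
      | succ m => exact pow_pos hb _
    have h := (interiorPointHard_powTower (ε := 1 / 150) (by norm_num) δ hb m).le_of_isAccurateRelease
      e hs m.succ_pos hkl hn hkm (by push_cast; linarith) hA hacc
    push_cast at h
    have hpos : (0 : ℝ) < k * (m + 1) := by positivity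
    -- Here `8αn` is at most an eighth of `k (m + 1)`, and `(149/150) · (7/8) > 0.86`.
    nlinarith
  rcases le_or_gt (64 * (α * n)) l with hcase | hcase
  · have hkr : 64 * (α * n) ≤ (min l n : ℕ) := by
      rw [Nat.cast_min, le_min_iff]
      exact ⟨hcase, by linarith⟩
    -- One row per instance suffices: `powTower 1 0 = 2` forces `|X| ≤ 1`, where log* vanishes.
    obtain ⟨hX, hcard⟩ := main (min l n) 0 1 (min_le_left _ _) (by omega) (by simp) one_pos
      (by simpa using hkr) (by push_cast; linarith)
    have h0 : logStar (Nat.card X) = 0 := by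
      refine Nat.le_zero.1 (logStar_le_of_le_twoTower 0 _ ?_)
      have : Nat.card X ≤ 1 := by simp only [powTower] at hcard; omega
      simpa [twoTower] using (by exact_mod_cast this : (Nat.card X : ℝ) ≤ 1)
    exact ⟨hX, by rw [h0]; simp⟩
  · set x : ℝ := 64 * (α * n) / l with hx
    have hx1 : 1 < x := by rwa [hx, one_lt_div (by linarith)]
    obtain ⟨m, hm⟩ : ∃ m, ⌈x⌉₊ = m + 1 := ⟨⌈x⌉₊ - 1, by
      have := Nat.ceil_pos.2 (zero_lt_one.trans hx1); omega⟩
    have hxm : x ≤ m + 1 := by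
      have := Nat.le_ceil x
      rw [hm] at this
      exact_mod_cast this
    have hmx : (m : ℝ) < x := by
      have := Nat.ceil_lt_add_one (zero_lt_one.trans hx1).le
      rw [hm] at this
      push_cast at this
      linarith
    have hm1 : (1 : ℝ) ≤ m := by
      have : (0 : ℝ) < m := by linarith
      exact_mod_cast this
    have hlx : l * x = 64 * (α * n) := by
      rw [hx]; field_simp
    -- Since `m + 1 < x + 1 < 2x`, the left side is at most `128αn ≤ (128/150) n`.
    have hlm : (l : ℝ) * (m + 1) ≤ n := by nlinarith
    have hδm : m * δ ≤ 1 / 7500 ∧ δ ≤ 1 / 7500 := by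
      have hln : (l : ℝ) ≤ n := by nlinarith
      have h1 : δ * (m + 1) ≤ 1 / 7500 := by
        have h2 : (l : ℝ) * (m + 1) * l ≤ n * n := by gcongr
        calc δ * (m + 1) ≤ (l : ℝ) ^ 2 / (7500 * (n : ℝ) ^ 2) * (m + 1) := by gcongr
          _ ≤ 1 / 7500 := by
            rw [div_mul_eq_mul_div, div_le_div_iff₀ (by positivity) (by norm_num)]
            nlinarith
      rcases le_or_gt δ 0 with h0 | h0 <;> constructor <;> nlinarith
    -- The alphabet size `2 ^ (m + 6)` keeps the total guessing cost of all `m` recursion steps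
    -- below a small constant, while raising the tower by only `O(m)` levels.
    have hb : (m : ℝ) * (Real.exp (1 / 150) / (2 ^ (m + 6) : ℕ)) ≤ 1.01 / 64 := by
      have : (m : ℝ) < 2 ^ m := by exact_mod_cast Nat.lt_two_pow_self
      push_cast
      rw [mul_div_assoc', div_le_div_iff₀ (by positivity) (by norm_num), pow_add]
      nlinarith [Real.exp_pos (1 / 150)]
    obtain ⟨hX, hcard⟩ := main l m (2 ^ (m + 6)) le_rfl hl (by exact_mod_cast hlm) (by positivity)
      (by nlinarith) (by rw [mul_add]; linarith)
    refine ⟨hX, ?_⟩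
    have htower := powTower_le_twoTower (d := m + 6) (by omega) m
    have hlog : logStar (Nat.card X) ≤ m + 6 + 1 + m := by
      refine logStar_le_of_le_twoTower _ _ ?_
      have : Nat.card X ≤ twoTower (m + 6 + 1 + m) := by nlinarith
      exact_mod_cast this
    -- `2m + 7 ≤ 10x` because `m < x` and `1 < x`; with `l x = 64αn` this gives the constant
    -- `1/640`.
    have hlog' : (logStar (Nat.card X) : ℝ) ≤ 10 * x := by
      have : (logStar (Nat.card X) : ℝ) ≤ m + 6 + 1 + m := by exact_mod_cast hlog
      linarith
    calc 1 / 640 * ((l : ℝ) / α * logStar (Nat.card X)) ≤ 1 / 640 * (l / α * (10 * x)) := by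
          gcongr
      _ = 1 / 64 * (l * x) / α := by ring
      _ = n := by rw [hlx]; field_simp
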